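/- Let $H_3$ be the Heisenberg group, i.e. the Lie group of real upper unitriangular $3\times 3$ matrices, with Lie algebra $\mathfrak h_3$ of left-invariant vector fields, and let $T$ be a left-invariant $(0,2)$-tensor field on $H_3$. There exist a left-invariant Riemannian metric $g$ on $H_3$ and a constant $c>0$ such that $$\mathrm{Ric}(g)=cT$$ if and only if there is a basis $V_1,V_2,V_3$ of $\mathfrak h_3$ satisfying the bracket relations $$[V_i,V_j]=\sum_{k=1}^{3}\epsilon_{ijk}\lambda_k V_k\qquad (i,j\in\{1,2,3\}),\qquad \lambda_1=2,\ \lambda_2=\lambda_3=0,$$ where $\epsilon_{ijk}$ is the Levi-Civita symbol, in which $T$ is diagonal, $T(V_i,V_j)=\delta_{ij}T_i$, with $T_1>0$, $T_2<0$ and $T_3<0$. Moreover, the pair $(g,c)$ is unique up to scaling of $g$: if $(g,c)$ and $(g',c')$ are two pairs, each consisting of a left-invariant Riemannian metric and a positive constant, with $\mathrm{Ric}(g)=cT$ and $\mathrm{Ric}(g')=c'T$, then $c'=c$ and $g'=ag$ for some constant $a>0$. -/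

import Mathlib

open scoped Manifold ContDiff

/-! ### Ricci curvature in coordinates -/

/-- The partial derivative `∂ᵢ f` of a function on `ℝⁿ`. -/
noncomputable def partialDeriv {n : ℕ} (i : Fin n) (f : EuclideanSpace ℝ (Fin n) → ℝ)
    (x : EuclideanSpace ℝ (Fin n)) : ℝ :=
  fderiv ℝ f x (EuclideanSpace.single i 1)

/-- The Christoffel symbols
`Γᵏᵢⱼ = ½ ∑ₗ gᵏˡ (∂ᵢ gⱼₗ + ∂ⱼ gᵢₗ - ∂ₗ gᵢⱼ)` of a Riemannian metric given in a coordinate chart by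
its matrix `G = (gᵢⱼ)`. -/
noncomputable def christoffel {n : ℕ}
    (G : EuclideanSpace ℝ (Fin n) → Matrix (Fin n) (Fin n) ℝ)
    (k i j : Fin n) (x : EuclideanSpace ℝ (Fin n)) : ℝ :=
  (1 / 2 : ℝ) * ∑ l, (G x)⁻¹ k l *
    (partialDeriv i (fun y => G y j l) x + partialDeriv j (fun y => G y i l) x
      - partialDeriv l (fun y => G y i j) x)

/-- The coordinate components
`Ricᵢⱼ = ∑ₖ (∂ₖ Γᵏᵢⱼ - ∂ⱼ Γᵏᵢₖ) + ∑ₖₗ (Γᵏₖₗ Γˡᵢⱼ - Γᵏⱼₗ Γˡᵢₖ)`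
of the Ricci curvature of a Riemannian metric with matrix `G` in a coordinate chart. -/
noncomputable def ricciCoord {n : ℕ}
    (G : EuclideanSpace ℝ (Fin n) → Matrix (Fin n) (Fin n) ℝ)
    (i j : Fin n) (x : EuclideanSpace ℝ (Fin n)) : ℝ :=
  ∑ k, (partialDeriv k (christoffel G k i j) x - partialDeriv j (christoffel G k i k) x
    + ∑ l, (christoffel G k k l x * christoffel G l i j x
      - christoffel G k j l x * christoffel G l i k x))

/-! ### The Heisenberg group as a Lie group -/

/-- The Heisenberg group `H₃` of real upper unitriangular `3 × 3` matrices
`(1, x, z; 0, 1, y; 0, 0, 1)`, as a manifold `ℝ³` through the global chart `(x, y, z)`. -/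
def Heis : Type := EuclideanSpace ℝ (Fin 3)

namespace Heis

instance : TopologicalSpace Heis := inferInstanceAs (TopologicalSpace (EuclideanSpace ℝ (Fin 3)))

instance : ChartedSpace (EuclideanSpace ℝ (Fin 3)) Heis :=
  inferInstanceAs (ChartedSpace (EuclideanSpace ℝ (Fin 3)) (EuclideanSpace ℝ (Fin 3)))

/-- The element with given coordinates. -/
def mk (x : EuclideanSpace ℝ (Fin 3)) : Heis := x

/-- The global chart. -/
def coord (p : Heis) : EuclideanSpace ℝ (Fin 3) := p

/-- Matrix multiplication: `(x, y, z) (x', y', z') = (x + x', y + y', z + z' + x y')`. -/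
noncomputable instance : Mul Heis :=
  ⟨fun p q => mk !₂[p.coord 0 + q.coord 0, p.coord 1 + q.coord 1,
    p.coord 2 + q.coord 2 + p.coord 0 * q.coord 1]⟩

noncomputable instance : One Heis := ⟨mk !₂[0, 0, 0]⟩

noncomputable instance : Inv Heis :=
  ⟨fun p => mk !₂[-p.coord 0, -p.coord 1, -p.coord 2 + p.coord 0 * p.coord 1]⟩

theorem mul_def (p q : Heis) : p * q = mk !₂[p.coord 0 + q.coord 0, p.coord 1 + q.coord 1,
    p.coord 2 + q.coord 2 + p.coord 0 * q.coord 1] := rfl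

theorem one_def : (1 : Heis) = mk !₂[0, 0, 0] := rfl

theorem inv_def (p : Heis) :
    p⁻¹ = mk !₂[-p.coord 0, -p.coord 1, -p.coord 2 + p.coord 0 * p.coord 1] := rfl

theorem coord_mk (x : EuclideanSpace ℝ (Fin 3)) : (mk x).coord = x := rfl

theorem ext_coord {p q : Heis} (h : ∀ i, p.coord i = q.coord i) : p = q :=
  PiLp.ext h

noncomputable instance : Group Heis where
  mul_assoc p q r := by
    apply ext_coord
    intro i
    fin_cases i <;> simp [mul_def, coord_mk] <;> ring
  one_mul p := by
    apply ext_coord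
    intro i
    fin_cases i <;> simp [mul_def, one_def, coord_mk]
  mul_one p := by
    apply ext_coord
    intro i
    fin_cases i <;> simp [mul_def, one_def, coord_mk]
  inv_mul_cancel p := by
    apply ext_coord
    intro i
    fin_cases i <;> simp [mul_def, one_def, inv_def, coord_mk]

instance (n : ℕ∞ω) : IsManifold (𝓡 3) n Heis :=
  inferInstanceAs (IsManifold (𝓡 3) n (EuclideanSpace ℝ (Fin 3)))

theorem contMDiff_coord (n : ℕ∞ω) : ContMDiff (𝓡 3) 𝓘(ℝ, EuclideanSpace ℝ (Fin 3)) n coord :=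
  contMDiff_id (I := 𝓡 3) (M := EuclideanSpace ℝ (Fin 3))

theorem contMDiff_mk (n : ℕ∞ω) : ContMDiff 𝓘(ℝ, EuclideanSpace ℝ (Fin 3)) (𝓡 3) n mk :=
  contMDiff_id (I := 𝓡 3) (M := EuclideanSpace ℝ (Fin 3))

instance (n : ℕ∞ω) : LieGroup (𝓡 3) n Heis where
  contMDiff_mul := by
    have h : ContDiff ℝ n (fun p : EuclideanSpace ℝ (Fin 3) × EuclideanSpace ℝ (Fin 3) =>
        !₂[p.1 0 + p.2 0, p.1 1 + p.2 1, p.1 2 + p.2 2 + p.1 0 * p.2 1]) := by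
      rw [contDiff_euclidean]
      intro i
      fin_cases i <;> simp <;> fun_prop
    have h₁ : ContMDiff ((𝓡 3).prod (𝓡 3)) 𝓘(ℝ, EuclideanSpace ℝ (Fin 3)) n
        (fun p : Heis × Heis => p.1.coord) := (contMDiff_coord n).comp contMDiff_fst
    have h₂ : ContMDiff ((𝓡 3).prod (𝓡 3)) 𝓘(ℝ, EuclideanSpace ℝ (Fin 3)) n
        (fun p : Heis × Heis => p.2.coord) := (contMDiff_coord n).comp contMDiff_snd
    exact (contMDiff_mk n).comp (h.contMDiff.comp (h₁.prodMk_space h₂))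
  contMDiff_inv := by
    have h : ContDiff ℝ n (fun p : EuclideanSpace ℝ (Fin 3) =>
        !₂[-p 0, -p 1, -p 2 + p 0 * p 1]) := by
      rw [contDiff_euclidean]
      intro i
      fin_cases i <;> simp <;> fun_prop
    exact (contMDiff_mk n).comp (h.contMDiff.comp (contMDiff_coord n))

/-! ### Left-invariant tensors, metrics and Milnor bases -/

/-- A field of bilinear forms on the tangent spaces of `H₃`, i.e. a `(0,2)`-tensor field. -/
abbrev TensorField02 : Type :=
  ∀ p : Heis, TangentSpace (𝓡 3) p →L[ℝ] TangentSpace (𝓡 3) p →L[ℝ] ℝ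

/-- `T` is invariant under all left translations `L_h`: `L_h^* T = T`.  (Such a field is
automatically smooth.) -/
def IsLeftInvariant (T : TensorField02) : Prop :=
  ∀ (h p : Heis) (u v : TangentSpace (𝓡 3) p),
    T (h * p) (mfderiv (𝓡 3) (𝓡 3) (fun q : Heis => h * q) p u)
      (mfderiv (𝓡 3) (𝓡 3) (fun q : Heis => h * q) p v) = T p u v

/-- Smooth Riemannian metrics on `H₃`. -/
abbrev Metric : Type :=
  Bundle.ContMDiffRiemannianMetric (𝓡 3) ∞ (EuclideanSpace ℝ (Fin 3))
    (fun p : Heis => TangentSpace (𝓡 3) p)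

/-- The matrix of a metric in the global chart of `H₃`. -/
noncomputable def metricMatrix (g : Metric) (x : EuclideanSpace ℝ (Fin 3)) :
    Matrix (Fin 3) (Fin 3) ℝ :=
  Matrix.of fun i j => g.inner (mk x)
    (EuclideanSpace.single i (1 : ℝ) : EuclideanSpace ℝ (Fin 3))
    (EuclideanSpace.single j (1 : ℝ) : EuclideanSpace ℝ (Fin 3))

/-- The Ricci curvature `Ric(g)(u, v)` at `p`, computed in the global chart of `H₃`
(in which the tangent space at `p` is identified with `ℝ³`). -/
noncomputable def ricci (g : Metric) (p : Heis) (u v : EuclideanSpace ℝ (Fin 3)) : ℝ :=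
  ∑ i, ∑ j, ricciCoord (metricMatrix g) i j p.coord * u i * v j

/-- `(g, c)` is a solution of `Ric(g) = c T` with `g` a left-invariant Riemannian metric and
`c > 0`. -/
def IsSolution (T : TensorField02) (g : Metric) (c : ℝ) : Prop :=
  IsLeftInvariant g.inner ∧ 0 < c ∧
    ∀ (p : Heis) (u v : TangentSpace (𝓡 3) p), ricci g p u v = c * T p u v

/-- The Lie algebra of `H₃` (with the bracket of left-invariant vector fields). -/
abbrev LieAlg : Type := GroupLieAlgebra (𝓡 3) Heis

/-- The Levi-Civita symbol `ε_{ijk}` for `i, j, k ∈ {0, 1, 2}`. -/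
noncomputable def leviCivita (i j k : Fin 3) : ℝ :=
  (((j : ℕ) : ℝ) - ((i : ℕ) : ℝ)) * (((k : ℕ) : ℝ) - ((i : ℕ) : ℝ)) *
    (((k : ℕ) : ℝ) - ((j : ℕ) : ℝ)) / 2

/-- The bracket relations `[Vᵢ, Vⱼ] = ∑ₖ ε_{ijk} λₖ Vₖ`. -/
def IsMilnorBasis (lam : Fin 3 → ℝ) (V : Module.Basis (Fin 3) ℝ LieAlg) : Prop :=
  ∀ i j, ⁅V i, V j⁆ = ∑ k, (leviCivita i j k * lam k) • V k

end Heis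

/-! In the chart the differential of a left translation is a shear depending only on the first
coordinate of the translating element. A left-invariant tensor is therefore determined by its value
at the identity, and its coordinate matrix depends on the first coordinate alone. Feeding such a
matrix into the Christoffel formulas gives, with `B` the metric at the identity, `e 2` spanning the
centre and `d = B (e 2) (e 2)`, Ric(u, v) = (d B(u, e₂) B(v, e₂) - (d² / 2) B(u, v)) / det B
(`ricciCoord_leftMatrix`, `ricci_eq`). Everything else is linear algebra with this formula
(`isSolution_iff`).

Ric is positive on the centre and equals the negative multiple -d² / (2 det B) of `B` on its
orthogonal complement. A `B`-orthogonal basis starting in the centre diagonalizes it with signs +,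
-, -, and Gram-Schmidt yields such a basis with the required brackets
(`exists_diagonal_of_solution`). Conversely, the bracket relations force `V 0` into the centre, and
reversing the sign of the two negative directions of T gives a scalar product whose Ricci form is a
positive multiple of T (`exists_solution_of_diagonal`). For uniqueness, putting v = e₂ in the
equation expresses B(u, e₂), then `B`, through T and the single number d. The constant `c` is
homogeneous of degree 0 in `B`, so it does not see the remaining scale (`eq_of_solution`,
`solution_unique`). -/

namespace HeisRicci

/-! ### Ricci curvature of metrics depending only on the first coordinate -/

/-- If `f` depends only on the first coordinate, its partial derivatives are read off from the
one-variable derivative. -/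
theorem partialDeriv_comp_zero {φ : ℝ → ℝ} {φ' : ℝ} (i : Fin 3)
    {x : EuclideanSpace ℝ (Fin 3)} (h : HasDerivAt φ φ' (x 0)) :
    partialDeriv i (fun y => φ (y 0)) x = if i = 0 then φ' else 0 := by
  have h0 : HasFDerivAt (fun y : EuclideanSpace ℝ (Fin 3) => y 0)
      (EuclideanSpace.proj (0 : Fin 3) : EuclideanSpace ℝ (Fin 3) →L[ℝ] ℝ) x :=
    (EuclideanSpace.proj (0 : Fin 3) : EuclideanSpace ℝ (Fin 3) →L[ℝ] ℝ).hasFDerivAt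
  have h1 : HasFDerivAt (fun y : EuclideanSpace ℝ (Fin 3) => φ (y 0)) _ x :=
    h.comp_hasFDerivAt x h0
  rw [partialDeriv, h1.fderiv]
  by_cases hi : i = 0
  · subst hi; simp
  · simp [hi, Ne.symm hi]

/-- The Christoffel symbols of a metric depending only on the first coordinate, in terms of the
inverse matrix `N` and the derivative `M'` of the matrix. -/
noncomputable def chris (N M' : Matrix (Fin 3) (Fin 3) ℝ) (k i j : Fin 3) : ℝ :=
  (1 / 2 : ℝ) * ∑ l, N k l * ((if i = 0 then M' j l else 0) + (if j = 0 then M' i l else 0)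
    - (if l = 0 then M' i j else 0))

theorem christoffel_comp_zero {M M' N : ℝ → Matrix (Fin 3) (Fin 3) ℝ}
    (hM : ∀ t i j, HasDerivAt (fun s => M s i j) (M' t i j) t) (hN : ∀ t, (M t)⁻¹ = N t)
    (k i j : Fin 3) :
    christoffel (fun x => M (x 0)) k i j = fun x => chris (N (x 0)) (M' (x 0)) k i j := by
  funext x
  simp only [christoffel, chris, hN]
  congr 1
  refine Finset.sum_congr rfl fun l _ => ?_
  rw [partialDeriv_comp_zero i (hM (x 0) j l), partialDeriv_comp_zero j (hM (x 0) i l),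
    partialDeriv_comp_zero l (hM (x 0) i j)]

theorem hasDerivAt_chris {M' M'' N N' : ℝ → Matrix (Fin 3) (Fin 3) ℝ} {t : ℝ}
    (hM : ∀ i j, HasDerivAt (fun s => M' s i j) (M'' t i j) t)
    (hN : ∀ i j, HasDerivAt (fun s => N s i j) (N' t i j) t) (k i j : Fin 3) :
    HasDerivAt (fun s => chris (N s) (M' s) k i j)
      (chris (N' t) (M' t) k i j + chris (N t) (M'' t) k i j) t := by
  have hite : ∀ (P : Prop) [Decidable P] (a b : Fin 3),
      HasDerivAt (fun s => if P then M' s a b else 0) (if P then M'' t a b else 0) t := by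
    intro P _ a b
    split_ifs
    · exact hM a b
    · exact hasDerivAt_const t 0
  have key : HasDerivAt (fun s => chris (N s) (M' s) k i j) _ t :=
    (HasDerivAt.fun_sum (u := Finset.univ) fun l _ => (hN k l).mul
      (((hite (i = 0) j l).add (hite (j = 0) i l)).sub (hite (l = 0) i j))).const_mul (1 / 2 : ℝ)
  convert key using 1
  simp only [chris, ← mul_add, ← Finset.sum_add_distrib]
  rfl

theorem ricciCoord_comp_zero {M M' M'' N N' : ℝ → Matrix (Fin 3) (Fin 3) ℝ}
    (hM : ∀ t i j, HasDerivAt (fun s => M s i j) (M' t i j) t)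
    (hM' : ∀ t i j, HasDerivAt (fun s => M' s i j) (M'' t i j) t)
    (hN : ∀ t, (M t)⁻¹ = N t)
    (hN' : ∀ t i j, HasDerivAt (fun s => N s i j) (N' t i j) t)
    (i j : Fin 3) (x : EuclideanSpace ℝ (Fin 3)) :
    ricciCoord (fun x => M (x 0)) i j x =
      ∑ k, ((if k = 0 then
          chris (N' (x 0)) (M' (x 0)) k i j + chris (N (x 0)) (M'' (x 0)) k i j else 0)
        - (if j = 0 then
          chris (N' (x 0)) (M' (x 0)) k i k + chris (N (x 0)) (M'' (x 0)) k i k else 0)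
        + ∑ l, (chris (N (x 0)) (M' (x 0)) k k l * chris (N (x 0)) (M' (x 0)) l i j
          - chris (N (x 0)) (M' (x 0)) k j l * chris (N (x 0)) (M' (x 0)) l i k)) := by
  simp only [ricciCoord, christoffel_comp_zero hM hN]
  refine Finset.sum_congr rfl fun k _ => ?_
  rw [partialDeriv_comp_zero (φ := fun s => chris (N s) (M' s) k i j) k
      (hasDerivAt_chris (hM' _) (hN' _) k i j),
    partialDeriv_comp_zero (φ := fun s => chris (N s) (M' s) k i k) j
      (hasDerivAt_chris (hM' _) (hN' _) k i k)]

/-! ### Coordinate matrices of left-invariant metrics and their Ricci curvature -/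

/-- The symmetric matrix with the given entries on and above the diagonal. -/
def symm3 (p q r a b d : ℝ) : Matrix (Fin 3) (Fin 3) ℝ := !![p, q, r; q, a, b; r, b, d]

theorem det_symm3 (p q r a b d : ℝ) :
    (symm3 p q r a b d).det = p * a * d + 2 * q * b * r - p * b ^ 2 - q ^ 2 * d - r ^ 2 * a := by
  rw [symm3, Matrix.det_fin_three]
  simp
  ring

theorem inv_symm3 {p q r a b d D : ℝ} (hD : (symm3 p q r a b d).det = D) (h : D ≠ 0) :
    (symm3 p q r a b d)⁻¹ = D⁻¹ • symm3 (a * d - b ^ 2) (r * b - q * d) (q * b - r * a)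
      (p * d - r ^ 2) (q * r - p * b) (p * a - q ^ 2) := by
  apply Matrix.inv_eq_right_inv
  rw [det_symm3] at hD
  have : symm3 p q r a b d * symm3 (a * d - b ^ 2) (r * b - q * d) (q * b - r * a)
      (p * d - r ^ 2) (q * r - p * b) (p * a - q ^ 2) = D • (1 : Matrix (Fin 3) (Fin 3) ℝ) := by
    rw [← hD]
    ext i j
    fin_cases i <;> fin_cases j <;>
      simp [symm3, Matrix.mul_apply, Fin.sum_univ_three] <;> ring
  rw [Matrix.mul_smul, this, smul_smul, inv_mul_cancel₀ h, one_smul]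

/-- The matrix at the points with first coordinate `t` of the left-invariant field of bilinear
forms on the Heisenberg group whose value at the identity is given. -/
def leftMatrix (p q r a b d t : ℝ) : Matrix (Fin 3) (Fin 3) ℝ :=
  symm3 p (q - t * r) r (a - 2 * t * b + t ^ 2 * d) (b - t * d) d

theorem chris_smul (e : ℝ) (N M' : Matrix (Fin 3) (Fin 3) ℝ) (k i j : Fin 3) :
    chris (e • N) M' k i j = e * chris N M' k i j := by
  simp only [chris, Matrix.smul_apply, smul_eq_mul, mul_assoc, ← Finset.mul_sum]
  ring

/-- The Ricci formula at one point, as a rational identity: `Q`, `A`, `B` stand for the entries that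
vary with the first coordinate, and their derivatives are already substituted. Clearing `D` leaves a
polynomial identity in each entry. -/
theorem ricci_sum_eq {p Q r A B d D : ℝ}
    (hD : p * A * d + 2 * Q * B * r - p * B ^ 2 - Q ^ 2 * d - r ^ 2 * A = D) (h : D ≠ 0)
    (i j : Fin 3) :
    ∑ k, ((if k = 0 then
          chris (D⁻¹ • symm3 0 0 (r * B - Q * d) 0 (p * d - r ^ 2) (2 * (Q * r - p * B)))
            (symm3 0 (-r) 0 (-2 * B) (-d) 0) k i j
          + chris (D⁻¹ • symm3 (A * d - B ^ 2) (r * B - Q * d) (Q * B - r * A) (p * d - r ^ 2)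
            (Q * r - p * B) (p * A - Q ^ 2)) (symm3 0 0 0 (2 * d) 0 0) k i j else 0)
        - (if j = 0 then
          chris (D⁻¹ • symm3 0 0 (r * B - Q * d) 0 (p * d - r ^ 2) (2 * (Q * r - p * B)))
            (symm3 0 (-r) 0 (-2 * B) (-d) 0) k i k
          + chris (D⁻¹ • symm3 (A * d - B ^ 2) (r * B - Q * d) (Q * B - r * A) (p * d - r ^ 2)
            (Q * r - p * B) (p * A - Q ^ 2)) (symm3 0 0 0 (2 * d) 0 0) k i k else 0)
        + ∑ l, (chris (D⁻¹ • symm3 (A * d - B ^ 2) (r * B - Q * d) (Q * B - r * A) (p * d - r ^ 2)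
            (Q * r - p * B) (p * A - Q ^ 2)) (symm3 0 (-r) 0 (-2 * B) (-d) 0) k k l
          * chris (D⁻¹ • symm3 (A * d - B ^ 2) (r * B - Q * d) (Q * B - r * A) (p * d - r ^ 2)
            (Q * r - p * B) (p * A - Q ^ 2)) (symm3 0 (-r) 0 (-2 * B) (-d) 0) l i j
          - chris (D⁻¹ • symm3 (A * d - B ^ 2) (r * B - Q * d) (Q * B - r * A) (p * d - r ^ 2)
            (Q * r - p * B) (p * A - Q ^ 2)) (symm3 0 (-r) 0 (-2 * B) (-d) 0) k j l
          * chris (D⁻¹ • symm3 (A * d - B ^ 2) (r * B - Q * d) (Q * B - r * A) (p * d - r ^ 2)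
            (Q * r - p * B) (p * A - Q ^ 2)) (symm3 0 (-r) 0 (-2 * B) (-d) 0) l i k)) =
      (d * symm3 p Q r A B d i 2 * symm3 p Q r A B d j 2
        - d ^ 2 / 2 * symm3 p Q r A B d i j) / D := by
  simp only [chris_smul]
  fin_cases i <;> fin_cases j <;>
  · simp [Fin.sum_univ_three, chris, symm3]
    field_simp
    rw [← hD]
    ring

theorem hasDerivAt_symm3 {p q r a b d : ℝ → ℝ} {p' q' r' a' b' d' t : ℝ}
    (hp : HasDerivAt p p' t) (hq : HasDerivAt q q' t) (hr : HasDerivAt r r' t)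
    (ha : HasDerivAt a a' t) (hb : HasDerivAt b b' t) (hd : HasDerivAt d d' t) (i j : Fin 3) :
    HasDerivAt (fun s => symm3 (p s) (q s) (r s) (a s) (b s) (d s) i j)
      (symm3 p' q' r' a' b' d' i j) t := by
  fin_cases i <;> fin_cases j <;> simpa [symm3]

/-- Shears are unimodular, so the determinant is the same at every point. The inverse matrix is then
the adjugate over a constant, polynomial in the first coordinate, and is differentiated entry by
entry. -/
theorem ricciCoord_leftMatrix {p q r a b d D : ℝ} (hD : (symm3 p q r a b d).det = D) (h : D ≠ 0)
    (i j : Fin 3) (x : EuclideanSpace ℝ (Fin 3)) :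
    ricciCoord (fun x => leftMatrix p q r a b d (x 0)) i j x =
      (d * leftMatrix p q r a b d (x 0) i 2 * leftMatrix p q r a b d (x 0) j 2
        - d ^ 2 / 2 * leftMatrix p q r a b d (x 0) i j) / D := by
  have hq : ∀ t, HasDerivAt (fun s => q - s * r) (-r) t := fun t => by
    simpa using ((hasDerivAt_id t).mul_const r).const_sub q
  have hb : ∀ t, HasDerivAt (fun s => b - s * d) (-d) t := fun t => by
    simpa using ((hasDerivAt_id t).mul_const d).const_sub b
  have ha : ∀ t, HasDerivAt (fun s => a - 2 * s * b + s ^ 2 * d) (-2 * (b - t * d)) t := fun t => by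
    have := ((((hasDerivAt_id t).const_mul 2).mul_const b).const_sub a).add
      (((hasDerivAt_id t).pow 2).mul_const d)
    refine this.congr_deriv ?_
    simp
    ring
  have hc : ∀ (y t : ℝ), HasDerivAt (fun _ => y) 0 t := fun y t => hasDerivAt_const t y
  have hD' : ∀ t, (leftMatrix p q r a b d t).det = D := fun t => by
    rw [← hD, leftMatrix, det_symm3, det_symm3]; ring
  rw [ricciCoord_comp_zero
    (M := fun t => leftMatrix p q r a b d t)
    (M' := fun t => symm3 0 (-r) 0 (-2 * (b - t * d)) (-d) 0)
    (M'' := fun _ => symm3 0 0 0 (2 * d) 0 0)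
    (N := fun t => D⁻¹ • symm3 ((a - 2 * t * b + t ^ 2 * d) * d - (b - t * d) ^ 2)
      (r * (b - t * d) - (q - t * r) * d) ((q - t * r) * (b - t * d) -
        r * (a - 2 * t * b + t ^ 2 * d))
      (p * d - r ^ 2) ((q - t * r) * r - p * (b - t * d))
      (p * (a - 2 * t * b + t ^ 2 * d) - (q - t * r) ^ 2))
    (N' := fun t => D⁻¹ • symm3 0 0 (r * (b - t * d) - (q - t * r) * d) 0 (p * d - r ^ 2)
      (2 * ((q - t * r) * r - p * (b - t * d))))
    (fun t => hasDerivAt_symm3 (hc _ t) (hq t) (hc _ t) (ha t) (hb t) (hc _ t))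
    (fun t => hasDerivAt_symm3 (hc _ t) (hc _ t) (hc _ t)
      (((hb t).const_mul (-2)).congr_deriv (by ring)) (hc _ t) (hc _ t))
    (fun t => inv_symm3 (hD' t) h)
    (fun t i j => (hasDerivAt_symm3
      ((((ha t).mul_const d).sub ((hb t).pow 2)).congr_deriv (by simp))
      ((((hb t).const_mul r).sub ((hq t).mul_const d)).congr_deriv (by ring))
      ((((hq t).mul (hb t)).sub ((ha t).const_mul r)).congr_deriv (by ring))
      (hc _ t)
      ((((hq t).mul_const r).sub ((hb t).const_mul p)).congr_deriv (by ring))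
      ((((ha t).const_mul p).sub ((hq t).pow 2)).congr_deriv (by simp; ring)) i j).const_mul D⁻¹)]
  have hx := hD' (x 0)
  simp only [leftMatrix] at hx ⊢
  rw [det_symm3] at hx
  exact ricci_sum_eq hx h i j

/-! ### Left translations, invariant vector fields and their bracket -/

open Heis

/-- The differential of left translation by an element with first coordinate `a`. -/
noncomputable def shear (a : ℝ) : EuclideanSpace ℝ (Fin 3) →L[ℝ] EuclideanSpace ℝ (Fin 3) :=
  ContinuousLinearMap.id ℝ _ + a • ((EuclideanSpace.proj (1 : Fin 3) :
    EuclideanSpace ℝ (Fin 3) →L[ℝ] ℝ).smulRight (EuclideanSpace.single (2 : Fin 3) (1 : ℝ)))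

@[simp] theorem shear_apply_zero (a : ℝ) (u : EuclideanSpace ℝ (Fin 3)) :
    shear a u 0 = u 0 := by simp [shear]

@[simp] theorem shear_apply_one (a : ℝ) (u : EuclideanSpace ℝ (Fin 3)) :
    shear a u 1 = u 1 := by simp [shear]

@[simp] theorem shear_apply_two (a : ℝ) (u : EuclideanSpace ℝ (Fin 3)) :
    shear a u 2 = u 2 + a * u 1 := by simp [shear]

theorem ext_three {u v : EuclideanSpace ℝ (Fin 3)} (h0 : u 0 = v 0) (h1 : u 1 = v 1)
    (h2 : u 2 = v 2) : u = v := by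
  ext i
  fin_cases i <;> assumption

@[simp] theorem shear_shear (a b : ℝ) (u : EuclideanSpace ℝ (Fin 3)) :
    shear a (shear b u) = shear (a + b) u := by
  apply ext_three <;> simp
  ring

@[simp] theorem shear_zero (u : EuclideanSpace ℝ (Fin 3)) : shear 0 u = u := by
  apply ext_three <;> simp

theorem mfderiv_mul_left (h p : Heis) :
    mfderiv (𝓡 3) (𝓡 3) (fun q : Heis => h * q) p = shear (h.coord 0) := by
  -- In the chart a left translation is affine, so its differential is the same linear part at every
  -- point.
  have key : (fun q : Heis => h * q) = fun q => mk (h.coord + shear (h.coord 0) q.coord) := by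
    funext q
    apply ext_coord
    intro i
    fin_cases i <;> simp [mul_def, coord_mk]
    ring
  rw [key]
  have := ((shear (h.coord 0)).hasFDerivAt (x := p.coord)).const_add h.coord
  exact this.hasMFDerivAt.mfderiv

theorem mulInvariantVectorField_apply (v : LieAlg) (p : Heis) :
    mulInvariantVectorField v p = shear (p.coord 0) v := by
  rw [mulInvariantVectorField, mfderiv_mul_left]
  rfl

theorem bracket_eq (u v : EuclideanSpace ℝ (Fin 3)) :
    Bracket.bracket (L := LieAlg) (M := LieAlg) u v =
      (EuclideanSpace.single (2 : Fin 3) (u 0 * v 1 - v 0 * u 1) : EuclideanSpace ℝ (Fin 3)) := by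
  have hf : ∀ w : EuclideanSpace ℝ (Fin 3), ∀ x : EuclideanSpace ℝ (Fin 3),
      HasFDerivAt (fun y : EuclideanSpace ℝ (Fin 3) => shear (y 0) w)
        ((EuclideanSpace.proj (0 : Fin 3) : EuclideanSpace ℝ (Fin 3) →L[ℝ] ℝ).smulRight
          (w 1 • (EuclideanSpace.single (2 : Fin 3) (1 : ℝ) : EuclideanSpace ℝ (Fin 3)))) x := by
    intro w x
    have h0 := ((EuclideanSpace.proj (0 : Fin 3) :
      EuclideanSpace ℝ (Fin 3) →L[ℝ] ℝ).smulRight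
          (w 1 • (EuclideanSpace.single (2 : Fin 3) (1 : ℝ) :
            EuclideanSpace ℝ (Fin 3)))).hasFDerivAt (x := x)
    exact h0.const_add w
  -- The manifold is its own model space, so the Lie bracket on the manifold is the vector-space
  -- bracket of the coordinate expressions of the invariant fields.
  have h1 : Bracket.bracket (L := LieAlg) (M := LieAlg) u v = VectorField.lieBracket ℝ
      (fun x : EuclideanSpace ℝ (Fin 3) => shear (x 0) u)
      (fun x : EuclideanSpace ℝ (Fin 3) => shear (x 0) v) (coord 1) := by
    have h2 := congrFun (VectorField.mlieBracketWithin_eq_lieBracketWithin (𝕜 := ℝ)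
      (V := fun x : EuclideanSpace ℝ (Fin 3) => shear (x 0) u)
      (W := fun x : EuclideanSpace ℝ (Fin 3) => shear (x 0) v) (s := Set.univ)) (coord 1)
    rw [VectorField.lieBracketWithin_univ] at h2
    have h3 := GroupLieAlgebra.bracket_def (I := 𝓡 3) (G := Heis) u v
    rw [funext (mulInvariantVectorField_apply u), funext (mulInvariantVectorField_apply v)] at h3
    exact h3.trans ((congrFun (VectorField.mlieBracketWithin_univ (I := 𝓡 3)
      (V := fun x : EuclideanSpace ℝ (Fin 3) => shear (x 0) u)
      (W := fun x : EuclideanSpace ℝ (Fin 3) => shear (x 0) v)).symm (coord 1)).trans h2)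
  rw [h1, VectorField.lieBracket, (hf u _).fderiv, (hf v _).fderiv]
  apply ext_three <;> simp [one_def, coord_mk]

/-- Translation by `p⁻¹` carries `p` to the identity. -/
theorem leftInvariant_apply {T : TensorField02} (hT : IsLeftInvariant T) (p : Heis)
    (u v : EuclideanSpace ℝ (Fin 3)) :
    T p u v = T 1 (shear (-p.coord 0) u) (shear (-p.coord 0) v) := by
  have h := hT p⁻¹ p u v
  rw [mfderiv_mul_left, inv_mul_cancel] at h
  exact h.symm

/-- The coordinate vectors. -/
noncomputable abbrev e (i : Fin 3) : EuclideanSpace ℝ (Fin 3) := EuclideanSpace.single i (1 : ℝ)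

/-! ### Left-invariant extension of a scalar product to a Riemannian metric -/

/-- The field of bilinear forms, in coordinates, which is the left-invariant extension of `B` at
the points with first coordinate `t`. -/
noncomputable def leftForm (B : EuclideanSpace ℝ (Fin 3) →L[ℝ] EuclideanSpace ℝ (Fin 3) →L[ℝ] ℝ)
    (t : ℝ) : EuclideanSpace ℝ (Fin 3) →L[ℝ] EuclideanSpace ℝ (Fin 3) →L[ℝ] ℝ :=
  B.bilinearComp (shear (-t)) (shear (-t))

theorem leftForm_apply (B : EuclideanSpace ℝ (Fin 3) →L[ℝ] EuclideanSpace ℝ (Fin 3) →L[ℝ] ℝ)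
    (t : ℝ) (u v : EuclideanSpace ℝ (Fin 3)) :
    leftForm B t u v = B (shear (-t) u) (shear (-t) v) := rfl

theorem contDiff_quadratic {F : Type*} [NormedAddCommGroup F] [NormedSpace ℝ F] (a b c : F) :
    ContDiff ℝ ∞ (fun t : ℝ => a - t • b + t ^ 2 • c) := by
  fun_prop

theorem contDiff_leftForm
    (B : EuclideanSpace ℝ (Fin 3) →L[ℝ] EuclideanSpace ℝ (Fin 3) →L[ℝ] ℝ) :
    ContDiff ℝ ∞ (leftForm B) := by
  -- The shear is affine in its parameter, with linear part `shear 1 - shear 0`, so the form is a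
  -- quadratic polynomial in `t`.
  have h : leftForm B = fun t => B
      - t • (B.bilinearComp (shear 1 - shear 0) (shear 0)
        + B.bilinearComp (shear 0) (shear 1 - shear 0))
      + t ^ 2 • B.bilinearComp (shear 1 - shear 0) (shear 1 - shear 0) := by
    funext t
    refine ContinuousLinearMap.ext fun u => ContinuousLinearMap.ext fun v => ?_
    have hs : ∀ w : EuclideanSpace ℝ (Fin 3),
        shear (-t) w = w - t • (shear 1 - shear 0) w := by
      intro w
      apply ext_three <;> simp
      ring
    rw [leftForm_apply, hs, hs]
    simp only [map_sub, map_smul, sub_apply, smul_apply,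
      add_apply, ContinuousLinearMap.bilinearComp_apply, shear_zero,
      smul_eq_mul]
    ring
  rw [h]
  exact contDiff_quadratic _ _ _

theorem isVonNBounded_of_pos
    {B : EuclideanSpace ℝ (Fin 3) →L[ℝ] EuclideanSpace ℝ (Fin 3) →L[ℝ] ℝ}
    (hB : ∀ u, u ≠ 0 → 0 < B u u) :
    Bornology.IsVonNBounded ℝ {u : EuclideanSpace ℝ (Fin 3) | B u u < 1} := by
  -- The minimum of the quadratic form on the compact unit sphere is a positive constant m, and
  -- homogeneity gives B(u, u) ≥ m ‖u‖².
  obtain ⟨w, hw, hmin⟩ := (isCompact_sphere (0 : EuclideanSpace ℝ (Fin 3)) 1).exists_isMinOn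
    ⟨e 0, by simp⟩ (f := fun u => B u u) (by fun_prop)
  have hw0 : w ≠ 0 := by
    rintro rfl
    simp at hw
  have hm := hB w hw0
  rw [NormedSpace.isVonNBounded_iff]
  refine isBounded_iff_forall_norm_le.2 ⟨(B w w)⁻¹ + 1, fun u hu => ?_⟩
  have hu : B u u < 1 := hu
  by_cases h0 : u = 0
  · subst h0
    simp
    positivity
  have hn : 0 < ‖u‖ := norm_pos_iff.2 h0
  have h1 : B w w ≤ B (‖u‖⁻¹ • u) (‖u‖⁻¹ • u) := hmin (by simp [norm_smul, hn.ne'])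
  simp only [map_smul, smul_apply, smul_eq_mul] at h1
  have h2 : B w w * ‖u‖ ^ 2 < 1 := by
    calc B w w * ‖u‖ ^ 2 ≤ (‖u‖⁻¹ * (‖u‖⁻¹ * B u u)) * ‖u‖ ^ 2 := by gcongr
      _ = B u u := by field_simp
      _ < 1 := hu
  have h3 : ‖u‖ ^ 2 ≤ (B w w)⁻¹ := by
    rw [← one_div, le_div_iff₀ hm]
    linarith
  nlinarith [sq_nonneg (‖u‖ - 1)]

theorem leftForm_pos {B : EuclideanSpace ℝ (Fin 3) →L[ℝ] EuclideanSpace ℝ (Fin 3) →L[ℝ] ℝ}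
    (hB : ∀ u, u ≠ 0 → 0 < B u u) (t : ℝ) (u : EuclideanSpace ℝ (Fin 3)) (hu : u ≠ 0) :
    0 < leftForm B t u u := by
  refine hB _ fun h => hu ?_
  have := congrArg (shear t) h
  simpa using this

/-- The left-invariant Riemannian metric with the given value at the identity. -/
noncomputable def leftMetric (B : EuclideanSpace ℝ (Fin 3) →L[ℝ] EuclideanSpace ℝ (Fin 3) →L[ℝ] ℝ)
    (hs : ∀ u v, B u v = B v u) (hB : ∀ u, u ≠ 0 → 0 < B u u) : Heis.Metric where
  inner p := leftForm B (p.coord 0)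
  symm _ u v := hs _ _
  pos p u hu := leftForm_pos hB (p.coord 0) u hu
  isVonNBounded p := isVonNBounded_of_pos (leftForm_pos hB (p.coord 0))
  contMDiff := by
    intro x
    have h : ContMDiff (𝓡 3) 𝓘(ℝ, EuclideanSpace ℝ (Fin 3) →L[ℝ] EuclideanSpace ℝ (Fin 3) →L[ℝ] ℝ)
        ∞ (fun p : Heis => leftForm B (p.coord 0)) := by
      have h0 : ContDiff ℝ ∞ (fun x : EuclideanSpace ℝ (Fin 3) => leftForm B (x 0)) :=
        (contDiff_leftForm B).comp (by fun_prop)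
      exact h0.contMDiff.comp (contMDiff_coord ∞)
    refine (Bundle.contMDiffAt_section _).2 ((h x).congr_of_eventuallyEq
      (Filter.Eventually.of_forall fun p => ?_))
    have hbase : p ∈ (trivializationAt (EuclideanSpace ℝ (Fin 3))
        (fun p : Heis => TangentSpace (𝓡 3) p) x).baseSet := Set.mem_univ p.coord
    -- The tangent bundle is trivialized by the identity, so the section read in the trivialization
    -- is the map `leftForm B` itself.
    have hsymm : ∀ v : EuclideanSpace ℝ (Fin 3),
        (trivializationAt (EuclideanSpace ℝ (Fin 3)) (fun p : Heis => TangentSpace (𝓡 3) p) x).symm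
          p v = v := fun v =>
      (Bundle.Trivialization.symmL_apply (R := ℝ) _ hbase v).symm.trans
      (congrArg (fun L : EuclideanSpace ℝ (Fin 3) →L[ℝ] EuclideanSpace ℝ (Fin 3) => L v)
        (TangentBundle.symmL_model_space (𝕜 := ℝ) (F := EuclideanSpace ℝ (Fin 3))
          x.coord p.coord))
    refine ContinuousLinearMap.ext fun v => ContinuousLinearMap.ext fun w => ?_
    refine (inCoordinates_apply_eq₂ (x₀ := x) (x := p) hbase hbase (Set.mem_univ p)).trans ?_
    refine (congrFun (Bundle.Trivialization.coe_linearMapAt_of_mem _ (Set.mem_univ p)) _).trans ?_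
    exact congrArg₂ (fun v w => leftForm B (p.coord 0) v w) (hsymm v) (hsymm w)

/-! ### Reduction of the Ricci equation to the identity element -/

theorem eq_sum_e (u : EuclideanSpace ℝ (Fin 3)) : u = u 0 • e 0 + u 1 • e 1 + u 2 • e 2 := by
  apply ext_three <;> simp

/-- The determinant of the Gram matrix of the coordinate vectors. -/
noncomputable def gramDet
    (B : EuclideanSpace ℝ (Fin 3) →L[ℝ] EuclideanSpace ℝ (Fin 3) →L[ℝ] ℝ) : ℝ :=
  (symm3 (B (e 0) (e 0)) (B (e 0) (e 1)) (B (e 0) (e 2)) (B (e 1) (e 1)) (B (e 1) (e 2))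
    (B (e 2) (e 2))).det

theorem symm_bilin_apply {B : EuclideanSpace ℝ (Fin 3) →L[ℝ] EuclideanSpace ℝ (Fin 3) →L[ℝ] ℝ}
    (hs : ∀ u v, B u v = B v u) (u v : EuclideanSpace ℝ (Fin 3)) :
    B u v = u 0 * v 0 * B (e 0) (e 0) + (u 0 * v 1 + u 1 * v 0) * B (e 0) (e 1)
      + (u 0 * v 2 + u 2 * v 0) * B (e 0) (e 2) + u 1 * v 1 * B (e 1) (e 1)
      + (u 1 * v 2 + u 2 * v 1) * B (e 1) (e 2) + u 2 * v 2 * B (e 2) (e 2) := by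
  conv_lhs => rw [eq_sum_e u, eq_sum_e v]
  simp only [map_add, map_smul, add_apply, smul_apply, smul_eq_mul]
  rw [hs (e 1) (e 0), hs (e 2) (e 0), hs (e 2) (e 1)]
  ring

theorem gramDet_pos {B : EuclideanSpace ℝ (Fin 3) →L[ℝ] EuclideanSpace ℝ (Fin 3) →L[ℝ] ℝ}
    (hs : ∀ u v, B u v = B v u) (hB : ∀ u, u ≠ 0 → 0 < B u u) : 0 < gramDet B := by
  apply Matrix.PosDef.det_pos
  apply Matrix.PosDef.of_dotProduct_mulVec_pos
  · ext i j
    fin_cases i <;> fin_cases j <;> simp [symm3]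
  · intro x hx
    have h := hB (WithLp.toLp 2 x) (by simpa using hx)
    rw [symm_bilin_apply hs] at h
    simp [symm3, dotProduct, Matrix.mulVec, Fin.sum_univ_three] at h ⊢
    linarith

theorem shear_e_two (a : ℝ) : shear a (e 2) = e 2 := by
  apply ext_three <;> simp

theorem metricMatrix_eq {g : Heis.Metric} (hg : IsLeftInvariant g.inner)
    {B : EuclideanSpace ℝ (Fin 3) →L[ℝ] EuclideanSpace ℝ (Fin 3) →L[ℝ] ℝ} (hB : B = g.inner 1) :
    metricMatrix g = fun x => leftMatrix (B (e 0) (e 0)) (B (e 0) (e 1)) (B (e 0) (e 2))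
      (B (e 1) (e 1)) (B (e 1) (e 2)) (B (e 2) (e 2)) (x 0) := by
  have hs : ∀ u v, B u v = B v u := by subst hB; exact g.symm 1
  have hentry : ∀ x i j, metricMatrix g x i j = B (shear (-x 0) (e i)) (shear (-x 0) (e j)) := by
    intro x i j
    subst hB
    exact leftInvariant_apply hg (mk x) (e i) (e j)
  have h0 : ∀ a, shear a (e 0) = e 0 := fun a => by apply ext_three <;> simp
  have h1 : ∀ a, shear a (e 1) = e 1 + a • e 2 := fun a => by apply ext_three <;> simp
  funext x
  ext i j
  rw [hentry]
  fin_cases i <;> fin_cases j <;>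
    simp [leftMatrix, symm3, h0, h1, shear_e_two, hs (e 1) (e 0), hs (e 2) (e 0), hs (e 2) (e 1)]
      <;> ring

/-- The Ricci curvature of a left-invariant metric in terms of its value at the identity. -/
theorem ricci_eq {g : Heis.Metric} (hg : IsLeftInvariant g.inner)
    {B : EuclideanSpace ℝ (Fin 3) →L[ℝ] EuclideanSpace ℝ (Fin 3) →L[ℝ] ℝ} (hB : B = g.inner 1)
    (hD : gramDet B ≠ 0) (p : Heis) (u v : EuclideanSpace ℝ (Fin 3)) :
    ricci g p u v = (B (e 2) (e 2) * B (shear (-p.coord 0) u) (e 2)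
      * B (shear (-p.coord 0) v) (e 2) - B (e 2) (e 2) ^ 2 / 2 *
        B (shear (-p.coord 0) u) (shear (-p.coord 0) v)) / gramDet B := by
  have hs : ∀ u v, B u v = B v u := by subst hB; exact g.symm 1
  simp only [ricci, metricMatrix_eq hg hB]
  simp only [ricciCoord_leftMatrix (show _ = gramDet B from rfl) hD, Fin.sum_univ_three]
  rw [symm_bilin_apply hs (shear (-p.coord 0) u) (e 2),
    symm_bilin_apply hs (shear (-p.coord 0) v) (e 2),
    symm_bilin_apply hs (shear (-p.coord 0) u) (shear (-p.coord 0) v)]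
  simp only [shear_apply_zero, shear_apply_one, shear_apply_two]
  simp [leftMatrix, symm3]
  field_simp
  ring

theorem leftMetric_isLeftInvariant
    {B : EuclideanSpace ℝ (Fin 3) →L[ℝ] EuclideanSpace ℝ (Fin 3) →L[ℝ] ℝ}
    (hs : ∀ u v, B u v = B v u) (hB : ∀ u, u ≠ 0 → 0 < B u u) :
    IsLeftInvariant (leftMetric B hs hB).inner := by
  intro h p u v
  rw [mfderiv_mul_left]
  have key : ∀ w, shear (-(h * p).coord 0) (shear (h.coord 0) w) = shear (-p.coord 0) w := by
    intro w
    simp [mul_def, coord_mk]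
  exact congrArg₂ (fun x y => B x y) (key u) (key v)

theorem leftMetric_inner_one
    {B : EuclideanSpace ℝ (Fin 3) →L[ℝ] EuclideanSpace ℝ (Fin 3) →L[ℝ] ℝ}
    (hs : ∀ u v, B u v = B v u) (hB : ∀ u, u ≠ 0 → 0 < B u u) :
    B = (leftMetric B hs hB).inner 1 := by
  refine ContinuousLinearMap.ext fun u => ContinuousLinearMap.ext fun v => ?_
  change B u v = B (shear (-0) u) (shear (-0) v)
  simp

theorem coord_one_zero : (1 : Heis).coord 0 = 0 := by simp [one_def, coord_mk]

/-- The equation `Ric(g) = c T` for left-invariant `g` and `T`, in terms of the values at the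
identity. -/
theorem isSolution_iff {T : TensorField02} (hT : IsLeftInvariant T) {g : Heis.Metric}
    (hg : IsLeftInvariant g.inner)
    {B τ : EuclideanSpace ℝ (Fin 3) →L[ℝ] EuclideanSpace ℝ (Fin 3) →L[ℝ] ℝ}
    (hB : B = g.inner 1) (hτ : τ = T 1) (hD : gramDet B ≠ 0) (c : ℝ) :
    IsSolution T g c ↔ 0 < c ∧ ∀ u v, B (e 2) (e 2) * B u (e 2) * B v (e 2)
      - B (e 2) (e 2) ^ 2 / 2 * B u v = gramDet B * (c * τ u v) := by
  constructor
  · rintro ⟨-, hc, h⟩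
    refine ⟨hc, fun u v => ?_⟩
    have h1 : ricci g 1 u v = c * τ u v := by subst hτ; exact h 1 u v
    rw [ricci_eq hg hB hD, coord_one_zero, neg_zero, shear_zero, shear_zero, div_eq_iff hD] at h1
    rw [h1, mul_comm]
  · rintro ⟨hc, h⟩
    refine ⟨hg, hc, fun p u v => ?_⟩
    have h1 : T p u v = τ (shear (-p.coord 0) u) (shear (-p.coord 0) v) := by
      subst hτ; exact leftInvariant_apply hT p u v
    rw [h1]
    exact (ricci_eq hg hB hD p u v).trans (by rw [h, mul_div_cancel_left₀ _ hD])

/-! ### Bases adapted to the bracket -/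

theorem isMilnorBasis_iff (V : Module.Basis (Fin 3) ℝ (EuclideanSpace ℝ (Fin 3)))
    (lam : Fin 3 → ℝ) :
    IsMilnorBasis lam V ↔ ∀ i j, EuclideanSpace.single (2 : Fin 3) (V i 0 * V j 1 - V j 0 * V i 1)
      = ∑ k, (leviCivita i j k * lam k) • V k := by
  refine forall_congr' fun i => forall_congr' fun j => ?_
  exact iff_of_eq (congrArg (· = ∑ k, (leviCivita i j k * lam k) • V k) (bracket_eq (V i) (V j)))

/-- With `V 0` central, the only relation with content is [V₁, V₂] = 2 V₀ = e₂, that is, the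
determinant condition `h12`. -/
theorem isMilnorBasis_of_eq {V : Module.Basis (Fin 3) ℝ (EuclideanSpace ℝ (Fin 3))}
    (h0 : V 0 = (1 / 2 : ℝ) • e 2) (h12 : V 1 0 * V 2 1 - V 2 0 * V 1 1 = 1) :
    IsMilnorBasis ![2, 0, 0] V := by
  rw [isMilnorBasis_iff]
  have h00 : V 0 0 = 0 := by rw [h0]; simp
  have h01 : V 0 1 = 0 := by rw [h0]; simp
  have h12' : V 2 0 * V 1 1 - V 1 0 * V 2 1 = -1 := by linarith
  intro i j
  have hz : EuclideanSpace.single (2 : Fin 3) (0 : ℝ) = 0 := by simp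
  have hn : EuclideanSpace.single (2 : Fin 3) (-1 : ℝ) = -e 2 := by
    apply ext_three <;> simp
  fin_cases i <;> fin_cases j <;>
    simp [leviCivita, Fin.sum_univ_three, h00, h01, h12, h12', hz, hn] <;>
    rw [h0, smul_smul] <;> norm_num

/-- The relation [V₁, V₂] = 2 V₀ puts `V 0` in the derived algebra, the line of `e 2`. -/
theorem IsMilnorBasis.exists_smul {V : Module.Basis (Fin 3) ℝ (EuclideanSpace ℝ (Fin 3))}
    (h : IsMilnorBasis ![2, 0, 0] V) : ∃ w : ℝ, w ≠ 0 ∧ V 0 = w • e 2 := by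
  have h12 := (isMilnorBasis_iff V _).1 h 1 2
  generalize V 1 0 * V 2 1 - V 2 0 * V 1 1 = m at h12
  have h0 : V 0 = (m / 2) • e 2 := by
    have h2 : EuclideanSpace.single (2 : Fin 3) m = (2 : ℝ) • V 0 := by
      rw [h12]
      simp [leviCivita, Fin.sum_univ_three]
      norm_num
    have h3 : V 0 = (2 : ℝ)⁻¹ • EuclideanSpace.single (2 : Fin 3) m := by
      rw [h2, smul_smul]; norm_num
    rw [h3]
    apply ext_three <;> simp
    ring
  refine ⟨m / 2, fun hm => V.ne_zero 0 ?_, h0⟩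
  rw [h0, hm, zero_smul]

/-- A Milnor basis which is orthogonal for a given scalar product. -/
theorem exists_orthogonal_milnorBasis
    {B : EuclideanSpace ℝ (Fin 3) →L[ℝ] EuclideanSpace ℝ (Fin 3) →L[ℝ] ℝ}
    (hs : ∀ u v, B u v = B v u) (hB : ∀ u, u ≠ 0 → 0 < B u u) :
    ∃ V : Module.Basis (Fin 3) ℝ (EuclideanSpace ℝ (Fin 3)), IsMilnorBasis ![2, 0, 0] V ∧
      V 0 = (1 / 2 : ℝ) • e 2 ∧ ∀ i j, i ≠ j → B (V i) (V j) = 0 := by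
  have hd : B (e 2) (e 2) ≠ 0 := (hB _ (by simp)).ne'
  -- Gram-Schmidt starting from the central vector. Subtracting multiples of `e 2` leaves
  -- coordinates 0 and 1 alone, and subtracting a multiple of `x` from `y` preserves their 2 × 2
  -- determinant, so the bracket stays `e 2`.
  obtain ⟨x, hx⟩ : ∃ x, x = e 0 - (B (e 0) (e 2) / B (e 2) (e 2)) • e 2 := ⟨_, rfl⟩
  obtain ⟨y, hy⟩ : ∃ y, y = e 1 - (B (e 1) (e 2) / B (e 2) (e 2)) • e 2 := ⟨_, rfl⟩
  have x0 : x 0 = 1 := by rw [hx]; simp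
  have x1 : x 1 = 0 := by rw [hx]; simp
  have y0 : y 0 = 0 := by rw [hy]; simp
  have y1 : y 1 = 1 := by rw [hy]; simp
  have hxx : B x x ≠ 0 := (hB x fun h => by simp [h] at x0).ne'
  have hxe : B x (e 2) = 0 := by
    rw [hx]
    simp only [map_sub, map_smul, sub_apply, smul_apply, smul_eq_mul]
    field_simp
    ring
  have hye : B y (e 2) = 0 := by
    rw [hy]
    simp only [map_sub, map_smul, sub_apply, smul_apply, smul_eq_mul]
    field_simp
    ring
  obtain ⟨m, hm⟩ : ∃ m, m = B x y / B x x := ⟨_, rfl⟩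
  have hxz : B x (y - m • x) = 0 := by
    simp only [map_sub, map_smul, smul_eq_mul, hm]
    field_simp
    ring
  have hze : B (y - m • x) (e 2) = 0 := by
    simp [hxe, hye]
  have hli : LinearIndependent ℝ ![(1 / 2 : ℝ) • e 2, x, y - m • x] := by
    rw [Fintype.linearIndependent_iff]
    intro a ha
    simp only [Fin.sum_univ_three, Matrix.cons_val] at ha
    have c0 := congrArg (fun u : EuclideanSpace ℝ (Fin 3) => u 0) ha
    have c1 := congrArg (fun u : EuclideanSpace ℝ (Fin 3) => u 1) ha
    have c2 := congrArg (fun u : EuclideanSpace ℝ (Fin 3) => u 2) ha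
    simp [x0, x1, y0, y1] at c0 c1 c2
    simp [c1] at c0
    simp [c0, c1] at c2
    intro i
    fin_cases i <;> assumption
  let V := basisOfLinearIndependentOfCardEqFinrank hli (by simp)
  have hV : ⇑V = ![(1 / 2 : ℝ) • e 2, x, y - m • x] :=
    coe_basisOfLinearIndependentOfCardEqFinrank hli _
  have V0 : V 0 = (1 / 2 : ℝ) • e 2 := by rw [hV]; rfl
  have V1 : V 1 = x := by rw [hV]; rfl
  have V2 : V 2 = y - m • x := by rw [hV]; rfl
  have h01 : B (V 0) (V 1) = 0 := by
    rw [V0, V1, hs, map_smul, hxe, smul_zero]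
  have h02 : B (V 0) (V 2) = 0 := by
    rw [V0, V2, hs, map_smul, hze, smul_zero]
  have h12 : B (V 1) (V 2) = 0 := by rw [V1, V2, hxz]
  refine ⟨V, isMilnorBasis_of_eq V0 (by rw [V1, V2]; simp [x0, x1, y0, y1]), V0, ?_⟩
  intro i j hij
  fin_cases i <;> fin_cases j
  · exact absurd rfl hij
  · exact h01
  · exact h02
  · exact (hs _ _).trans h01
  · exact absurd rfl hij
  · exact h12
  · exact (hs _ _).trans h02
  · exact (hs _ _).trans h12
  · exact absurd rfl hij

/-! ### Existence: diagonal form with signs +, -, - -/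

theorem exists_diagonal_of_solution
    {B τ : EuclideanSpace ℝ (Fin 3) →L[ℝ] EuclideanSpace ℝ (Fin 3) →L[ℝ] ℝ}
    (hs : ∀ u v, B u v = B v u) (hB : ∀ u, u ≠ 0 → 0 < B u u) {c : ℝ} (hc : 0 < c)
    (h : ∀ u v, B (e 2) (e 2) * B u (e 2) * B v (e 2) - B (e 2) (e 2) ^ 2 / 2 * B u v
      = gramDet B * (c * τ u v)) :
    ∃ (V : Module.Basis (Fin 3) ℝ (EuclideanSpace ℝ (Fin 3))) (t : Fin 3 → ℝ),
      IsMilnorBasis ![2, 0, 0] V ∧ (∀ i j, τ (V i) (V j) = if i = j then t i else 0) ∧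
      0 < t 0 ∧ t 1 < 0 ∧ t 2 < 0 := by
  obtain ⟨V, hV, hV0, horth⟩ := exists_orthogonal_milnorBasis hs hB
  have hD := gramDet_pos hs hB
  have hd : 0 < B (e 2) (e 2) := hB _ (by simp)
  have hK : 0 < gramDet B * c := mul_pos hD hc
  have he : e 2 = (2 : ℝ) • V 0 := by rw [hV0, smul_smul]; norm_num
  have hperp : ∀ i, i ≠ 0 → B (V i) (e 2) = 0 := by
    intro i hi
    rw [he, map_smul, horth i 0 hi, smul_zero]
  have hneg : ∀ i, i ≠ 0 → τ (V i) (V i) < 0 := by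
    intro i hi
    have h1 := h (V i) (V i)
    rw [hperp i hi] at h1
    have h2 : 0 < B (e 2) (e 2) ^ 2 / 2 * B (V i) (V i) :=
      mul_pos (by positivity) (hB _ (V.ne_zero i))
    by_contra! h3
    have := mul_nonneg hK.le h3
    linarith
  refine ⟨V, fun i => τ (V i) (V i), hV, fun i j => ?_, ?_, hneg 1 (by decide),
    hneg 2 (by decide)⟩
  · split_ifs with hij
    · rw [hij]
    · have h1 := h (V i) (V j)
      rw [horth i j hij] at h1
      have h2 : B (V i) (e 2) * B (V j) (e 2) = 0 := by
        by_cases hi : i = 0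
        · rw [hperp j (fun hj => hij (hi.trans hj.symm)), mul_zero]
        · rw [hperp i hi, zero_mul]
      rw [mul_assoc, h2, ← mul_assoc] at h1
      simpa [hK.ne'] using h1
  · have h1 := h (V 0) (V 0)
    have h2 : B (V 0) (e 2) = 1 / 2 * B (e 2) (e 2) := by rw [hV0]; simp
    have h3 : B (V 0) (V 0) = 1 / 2 * (1 / 2 * B (e 2) (e 2)) := by rw [hV0]; simp
    rw [h2, h3] at h1
    by_contra! h4
    have h5 : gramDet B * c * τ (V 0) (V 0) ≤ 0 := mul_nonpos_of_nonneg_of_nonpos hK.le h4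
    -- With d = B(e₂, e₂) and V₀ = e₂ / 2, the left side of `h1` is d · (d/2)² - (d²/2) · (d/4) =
    -- d³/8.
    have h6 : 0 < B (e 2) (e 2) ^ 3 / 8 := by positivity
    nlinarith

theorem exists_solution_of_diagonal
    {τ : EuclideanSpace ℝ (Fin 3) →L[ℝ] EuclideanSpace ℝ (Fin 3) →L[ℝ] ℝ}
    {V : Module.Basis (Fin 3) ℝ (EuclideanSpace ℝ (Fin 3))} {t : Fin 3 → ℝ}
    (hV : IsMilnorBasis ![2, 0, 0] V) (hτ : ∀ i j, τ (V i) (V j) = if i = j then t i else 0)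
    (h0 : 0 < t 0) (h1 : t 1 < 0) (h2 : t 2 < 0) :
    ∃ (B : EuclideanSpace ℝ (Fin 3) →L[ℝ] EuclideanSpace ℝ (Fin 3) →L[ℝ] ℝ) (c : ℝ),
      (∀ u v, B u v = B v u) ∧ (∀ u, u ≠ 0 → 0 < B u u) ∧ 0 < c ∧
      ∀ u v, B (e 2) (e 2) * B u (e 2) * B v (e 2) - B (e 2) (e 2) ^ 2 / 2 * B u v
        = gramDet B * (c * τ u v) := by
  obtain ⟨w, hw, hV0⟩ := IsMilnorBasis.exists_smul hV
  have hexp : ∀ u v, τ u v = V.repr u 0 * V.repr v 0 * t 0 + V.repr u 1 * V.repr v 1 * t 1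
      + V.repr u 2 * V.repr v 2 * t 2 := by
    intro u v
    conv_lhs => rw [← V.sum_repr u, ← V.sum_repr v]
    simp only [Fin.sum_univ_three, map_add, map_smul, add_apply, smul_apply, smul_eq_mul, hτ]
    simp
    ring
  have hτ0 : ∀ u, τ u (V 0) = V.repr u 0 * t 0 := by
    intro u
    rw [hexp]
    simp
  -- The first dual coordinate is a multiple of τ(·, V₀), which makes it a continuous linear form.
  obtain ⟨φ, hφ⟩ : ∃ φ : EuclideanSpace ℝ (Fin 3) →L[ℝ] ℝ, ∀ u, φ u = V.repr u 0 :=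
    ⟨(t 0)⁻¹ • τ.flip (V 0), fun u => by simp [hτ0]; field_simp⟩
  -- This `B` is diagonal in `V` with entries 1, -t₁/t₀, -t₂/t₀: dividing -τ by t₀ makes the last
  -- two entries positive, and the term 2 φ ⊗ φ turns the first from -1 into 1.
  obtain ⟨B, hBdef⟩ : ∃ B : EuclideanSpace ℝ (Fin 3) →L[ℝ] EuclideanSpace ℝ (Fin 3) →L[ℝ] ℝ,
      ∀ u v, B u v = 2 * (V.repr u 0 * V.repr v 0) - (t 0)⁻¹ * τ u v :=
    ⟨(2 : ℝ) • φ.smulRight φ - (t 0)⁻¹ • τ, fun u v => by simp [hφ]⟩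
  have hs : ∀ u v, B u v = B v u := by
    intro u v
    rw [hBdef, hBdef, hexp u v, hexp v u]
    ring
  have hB : ∀ u, u ≠ 0 → 0 < B u u := by
    intro u hu
    have key : B u u = V.repr u 0 ^ 2 + -t 1 / t 0 * V.repr u 1 ^ 2
        + -t 2 / t 0 * V.repr u 2 ^ 2 := by
      rw [hBdef, hexp]
      field_simp
      ring
    have p1 : 0 < -t 1 / t 0 := div_pos (neg_pos.2 h1) h0
    have p2 : 0 < -t 2 / t 0 := div_pos (neg_pos.2 h2) h0
    rw [key]
    refine lt_of_le_of_ne (by positivity) fun hz => hu ?_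
    have q0 := sq_nonneg (V.repr u 0)
    have q1 := mul_nonneg p1.le (sq_nonneg (V.repr u 1))
    have q2 := mul_nonneg p2.le (sq_nonneg (V.repr u 2))
    have r0 : V.repr u 0 ^ 2 = 0 := by linarith
    have r1 : -t 1 / t 0 * V.repr u 1 ^ 2 = 0 := by linarith
    have r2 : -t 2 / t 0 * V.repr u 2 ^ 2 = 0 := by linarith
    apply V.ext_elem
    intro i
    fin_cases i
    · simpa using r0
    · simpa [p1.ne'] using (mul_eq_zero.1 r1).resolve_left p1.ne'
    · simpa [p2.ne'] using (mul_eq_zero.1 r2).resolve_left p2.ne'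
  have hD := gramDet_pos hs hB
  have he : e 2 = w⁻¹ • V 0 := by rw [hV0, smul_smul, inv_mul_cancel₀ hw, one_smul]
  have hBe : ∀ u, B u (e 2) = w⁻¹ * V.repr u 0 := by
    intro u
    rw [he, map_smul, hBdef, hτ0, smul_eq_mul]
    simp
    field_simp
    norm_num
  have hee : B (e 2) (e 2) = w⁻¹ ^ 2 := by
    rw [hBe, he]
    simp
    ring
  -- With B(e₂, e₂) = w⁻² and B(u, e₂) = w⁻¹ u₀, where u₀ is the first coordinate of u in `V`, the φ
  -- ⊗ φ terms cancel and the left side is w⁻⁴ τ(u, v) / (2 t₀), which dictates the constant.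
  refine ⟨B, (2 * gramDet B * w ^ 4 * t 0)⁻¹, hs, hB, by positivity, fun u v => ?_⟩
  rw [hee, hBe, hBe, hBdef]
  field_simp
  ring

/-! ### Uniqueness up to scaling -/

/-- A solution is determined by the tensor up to scaling. -/
theorem eq_of_solution
    {B τ : EuclideanSpace ℝ (Fin 3) →L[ℝ] EuclideanSpace ℝ (Fin 3) →L[ℝ] ℝ}
    (hs : ∀ u v, B u v = B v u) (hB : ∀ u, u ≠ 0 → 0 < B u u) {c : ℝ} (hc : 0 < c)
    (h : ∀ u v, B (e 2) (e 2) * B u (e 2) * B v (e 2) - B (e 2) (e 2) ^ 2 / 2 * B u v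
      = gramDet B * (c * τ u v)) :
    0 < τ (e 2) (e 2) ∧ c = B (e 2) (e 2) ^ 3 / (2 * gramDet B * τ (e 2) (e 2)) ∧
    ∀ u v, B u v = B (e 2) (e 2) * (2 * (τ u (e 2) / τ (e 2) (e 2)) *
      (τ v (e 2) / τ (e 2) (e 2)) - τ u v / τ (e 2) (e 2)) := by
  have hD := gramDet_pos hs hB
  have hd : 0 < B (e 2) (e 2) := hB _ (by simp)
  have hK : 0 < gramDet B * c := mul_pos hD hc
  -- Setting v = e₂ merges the two terms on the left into (d²/2) B(u, e₂), which is linear in the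
  -- unknown B(u, e₂) once d = B(e₂, e₂) is fixed.
  have h1 : ∀ u, B (e 2) (e 2) ^ 2 * B u (e 2) = 2 * (gramDet B * c) * τ u (e 2) := by
    intro u
    linear_combination 2 * h u (e 2)
  have hk : 0 < τ (e 2) (e 2) := by
    have h2 : 0 < 2 * (gramDet B * c) * τ (e 2) (e 2) := by rw [← h1]; positivity
    exact (pos_iff_pos_of_mul_pos h2).1 (by positivity)
  have hc' : c = B (e 2) (e 2) ^ 3 / (2 * gramDet B * τ (e 2) (e 2)) := by
    rw [eq_div_iff (by positivity)]
    linear_combination -h1 (e 2)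
  refine ⟨hk, hc', fun u v => ?_⟩
  have h2 : ∀ u, B u (e 2) = B (e 2) (e 2) * (τ u (e 2) / τ (e 2) (e 2)) := by
    intro u
    have h3 := h1 u
    rw [hc'] at h3
    field_simp at h3 ⊢
    linarith
  have h4 := h u v
  rw [h2 u, h2 v, hc'] at h4
  generalize B (e 2) (e 2) = d at *
  generalize τ (e 2) (e 2) = k at *
  field_simp at h4 ⊢
  linarith

theorem gramDet_smul {B B' : EuclideanSpace ℝ (Fin 3) →L[ℝ] EuclideanSpace ℝ (Fin 3) →L[ℝ] ℝ}
    {a : ℝ} (h : ∀ u v, B' u v = a * B u v) : gramDet B' = a ^ 3 * gramDet B := by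
  simp only [gramDet, det_symm3, h]
  ring

/-- Both forms are multiples of one form built from `τ`, so they are proportional. In the formula
for `c` the numerator and `gramDet` both scale by the cube of the factor, which therefore cancels.
-/
theorem solution_unique
    {B B' τ : EuclideanSpace ℝ (Fin 3) →L[ℝ] EuclideanSpace ℝ (Fin 3) →L[ℝ] ℝ}
    (hs : ∀ u v, B u v = B v u) (hB : ∀ u, u ≠ 0 → 0 < B u u)
    (hs' : ∀ u v, B' u v = B' v u) (hB' : ∀ u, u ≠ 0 → 0 < B' u u)
    {c c' : ℝ} (hc : 0 < c) (hc' : 0 < c')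
    (h : ∀ u v, B (e 2) (e 2) * B u (e 2) * B v (e 2) - B (e 2) (e 2) ^ 2 / 2 * B u v
      = gramDet B * (c * τ u v))
    (h' : ∀ u v, B' (e 2) (e 2) * B' u (e 2) * B' v (e 2) - B' (e 2) (e 2) ^ 2 / 2 * B' u v
      = gramDet B' * (c' * τ u v)) :
    c' = c ∧ ∃ a : ℝ, 0 < a ∧ ∀ u v, B' u v = a * B u v := by
  obtain ⟨hk, hceq, hBeq⟩ := eq_of_solution hs hB hc h
  obtain ⟨-, hceq', hBeq'⟩ := eq_of_solution hs' hB' hc' h'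
  have hd : 0 < B (e 2) (e 2) := hB _ (by simp)
  have hd' : 0 < B' (e 2) (e 2) := hB' _ (by simp)
  have hD := gramDet_pos hs hB
  have hscale : ∀ u v, B' u v = B' (e 2) (e 2) / B (e 2) (e 2) * B u v := by
    intro u v
    rw [hBeq u v, hBeq' u v]
    field_simp
  refine ⟨?_, _, div_pos hd' hd, hscale⟩
  rw [hceq', hceq, gramDet_smul hscale]
  field_simp

end HeisRicci

theorem mainTheorem6 (T : Heis.TensorField02) (hT : Heis.IsLeftInvariant T) :
    ((∃ (g : Heis.Metric) (c : ℝ), Heis.IsSolution T g c) ↔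
      ∃ (V : Module.Basis (Fin 3) ℝ Heis.LieAlg) (t : Fin 3 → ℝ),
        Heis.IsMilnorBasis ![2, 0, 0] V ∧
        (∀ i j, T 1 (V i) (V j) = if i = j then t i else 0) ∧
        0 < t 0 ∧ t 1 < 0 ∧ t 2 < 0) ∧
    (∀ (g g' : Heis.Metric) (c c' : ℝ), Heis.IsSolution T g c → Heis.IsSolution T g' c' →
      c' = c ∧ ∃ a : ℝ, 0 < a ∧
        ∀ (p : Heis) (u v : TangentSpace (𝓡 3) p), g'.inner p u v = a * g.inner p u v) := by
  have hdet : ∀ g : Heis.Metric, HeisRicci.gramDet (g.inner 1) ≠ 0 := fun g =>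
    (HeisRicci.gramDet_pos (g.symm 1) (g.pos 1)).ne'
  refine ⟨⟨?_, ?_⟩, ?_⟩
  · rintro ⟨g, c, hg⟩
    obtain ⟨hc, h⟩ := (HeisRicci.isSolution_iff hT hg.1 rfl rfl (hdet g) c).1 hg
    exact HeisRicci.exists_diagonal_of_solution (g.symm 1) (g.pos 1) hc h
  · rintro ⟨V, t, hV, hτ, h0, h1, h2⟩
    obtain ⟨B, c, hs, hB, hc, h⟩ :=
      HeisRicci.exists_solution_of_diagonal (τ := T 1) (V := V) hV hτ h0 h1 h2
    exact ⟨HeisRicci.leftMetric B hs hB, c,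
      (HeisRicci.isSolution_iff hT (HeisRicci.leftMetric_isLeftInvariant hs hB)
        (HeisRicci.leftMetric_inner_one hs hB) rfl
        (HeisRicci.gramDet_pos hs hB).ne' c).2 ⟨hc, h⟩⟩
  · intro g g' c c' hg hg'
    obtain ⟨hc, h⟩ := (HeisRicci.isSolution_iff hT hg.1 rfl rfl (hdet g) c).1 hg
    obtain ⟨hc', h'⟩ := (HeisRicci.isSolution_iff hT hg'.1 rfl rfl (hdet g') c').1 hg'
    obtain ⟨hcc, a, ha, hscale⟩ := HeisRicci.solution_unique (g.symm 1) (g.pos 1)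
      (g'.symm 1) (g'.pos 1) hc hc' h h'
    refine ⟨hcc, a, ha, fun p u v => ?_⟩
    -- Proportionality at the identity spreads to every `p`, since both metrics at `p` are pulled
    -- back from the identity by the same shear.
    exact (HeisRicci.leftInvariant_apply hg'.1 p u v).trans
      ((hscale _ _).trans (congrArg (a * ·) (HeisRicci.leftInvariant_apply hg.1 p u v).symm))
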